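/- Let $\Gamma=\mathrm{SL}_2(\mathbb Z)$ act on the upper half-plane $\mathbb H$, let $k\in\mathbb Z$, and let $F\in M_k(\Gamma)$ be a nonzero modular form of weight $k$: a holomorphic function $F:\mathbb H\to\mathbb C$ with $F\left(\frac{a\tau+b}{c\tau+d}\right)=(c\tau+d)^kF(\tau)$ for all $\begin{pmatrix}a&b\\c&d\end{pmatrix}\in\Gamma$ and $\tau\in\mathbb H$, such that $|F(\tau)|$ remains bounded as $\Im(\tau)\to\infty$. For $\tau_0\in\mathbb H$ let $v_{\tau_0}(F)$ be the order of vanishing of $F$ at $\tau_0$, i.e. the unique integer $v$ such that $F(\tau)/(\tau-\tau_0)^v$ is holomorphic and nonzero at $\tau_0$. Write $F(\tau)=G(e^{2\pi i\tau})$ with $G$ holomorphic on the open unit disc, and let $v_{i\infty}(F)$ be the order of vanishing of $G$ at $0$. Let $$\mathfrak F=\left\{\tau\in\mathbb H:\ -\tfrac12\le\Re(\tau)<\tfrac12,\ |\tau|\ge1,\ \text{and } \Re(\tau)\le0 \text{ if } |\tau|=1\right\}$$ be the standard strict fundamental domain, which contains exactly one point of each $\Gamma$-orbit in $\mathbb H$.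 Let $\rho=e^{2\pi i/3}$, $e_i=2$, $e_\rho=3$, and $e_\tau=1$ for every other $\tau\in\mathfrak F$. Then all these orders of vanishing are finite, $v_\tau(F)\neq0$ for only finitely many $\tau\in\mathfrak F$, and $$v_{i\infty}(F)+\sum_{\tau\in\mathfrak F}\frac{v_\tau(F)}{e_\tau}=\frac{k}{12}.$$ -/

import Mathlib

open scoped MatrixGroups ModularForm

namespace ValenceFormula

/-- The strict fundamental domain for the action of `SL(2, ℤ)` on the upper half-plane: it contains
exactly one point of every orbit. Of the two halves of the boundary arc `|τ| = 1`, which are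
identified by `τ ↦ -1/τ`, only the left one is kept. -/
def fundDomain : Set UpperHalfPlane :=
  {τ | -(1 / 2 : ℝ) ≤ τ.re ∧ τ.re < 1 / 2 ∧ 1 ≤ ‖(τ : ℂ)‖ ∧ (‖(τ : ℂ)‖ = 1 → τ.re ≤ 0)}

/-- The order of vanishing at `τ₀` of a holomorphic function on the upper half-plane, in `ℕ ∪ {∞}`
(it is `∞` exactly if the function vanishes near `τ₀`). -/
noncomputable def orderAt (F : UpperHalfPlane → ℂ) (τ₀ : UpperHalfPlane) : ℕ∞ :=
  analyticOrderAt (F ∘ UpperHalfPlane.ofComplex) (τ₀ : ℂ)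

/-- The order of vanishing at `i∞` of a `1`-periodic holomorphic function `F` bounded at `i∞`, i.e. the order of vanishing at
`q = 0` of the function `G` with `F τ = G (exp (2 π i τ))`. -/
noncomputable def orderAtInfty (F : UpperHalfPlane → ℂ) : ℕ∞ :=
  analyticOrderAt (UpperHalfPlane.cuspFunction 1 F) 0

open Classical in
/-- The weights `e_τ`: `e_i = 2`, `e_ρ = 3` for `ρ = exp (2 π i / 3)`, and `e_τ = 1` otherwise. -/
noncomputable def ellipticWeight (τ : UpperHalfPlane) : ℕ :=
  if τ = UpperHalfPlane.I then 2 else if τ = UpperHalfPlane.ρ then 3 else 1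

end ValenceFormula

/-! The valence formula reduces to counting roots of a polynomial, with no contour integral. The
form `F ^ 12` has weight `12 k`, so it equals `Δ ^ k * P(j)` for a polynomial `P`, and the degree of
`P` drops from `k` exactly by the order at the cusp: `12 v_∞(F) + deg P = k`
(`exists_polynomial_kleinJ`). As `Δ` has no zero on `ℍ`, `12 v_τ(F)` is the multiplicity of `j(τ)`
as a root of `P` times the ramification index of `j` at `τ`. That index is `e_τ`
(`analyticOrderAt_kleinJ`), and `j` maps the strict fundamental domain bijectively onto `ℂ`
(`bijOn_kleinJ_fundDomain`). Hence the sum of `12 v_τ(F) / e_τ` is `deg P`.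

The bijectivity of `j` must not rest on the valence formula. It is topological: `j` is open and
proper on the quotient, hence surjective. It is injective near the cusp because `1 / j = q + O(q²)`,
and connectedness of the plane minus the countably many critical values spreads injectivity
everywhere. -/

namespace ValenceFormula
-- Injectivity criterion and local behaviour of analytic maps
open Set Filter Topology

/-- A continuous open and closed map to `ℂ` that is locally injective outside the fibres over a
countable set, and that has at least one fibre with at most one point outside that set,
is injective. -/
theorem injective_of_isOpenMap_of_isClosedMap {X : Type*} [TopologicalSpace X] [T2Space X]
    {f : X → ℂ} (hfo : IsOpenMap f) (hfc : IsClosedMap f) {D : Set ℂ}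
    (hD : D.Countable) (hloc : ∀ x, f x ∉ D → ∃ U ∈ 𝓝 x, InjOn f U) {c₀ : ℂ} (hc₀ : c₀ ∉ D)
    (hc₀' : (f ⁻¹' {c₀}).Subsingleton) : Function.Injective f := by
  set B : Set ℂ := {c | ∃ x y, x ≠ y ∧ f x = c ∧ f y = c} with hB
  -- Disjoint neighbourhoods of two points over `c` have open images, which overlap around `c`.
  have hBo : IsOpen B := by
    rw [isOpen_iff_mem_nhds]
    rintro c ⟨x, y, hxy, rfl, hy⟩
    obtain ⟨u, v, hu, hv, hxu, hyv, huv⟩ := t2_separation hxy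
    have h1 := (hfo u hu).mem_nhds (mem_image_of_mem f hxu)
    have h2 := (hfo v hv).mem_nhds (mem_image_of_mem f hyv)
    rw [hy] at h2
    filter_upwards [h1, h2]
    rintro _ ⟨a, ha, rfl⟩ ⟨b, hb, hab⟩
    exact ⟨a, b, fun h ↦ disjoint_left.mp huv ha (h ▸ hb), rfl, hab⟩
  have hAo : IsOpen (interior Bᶜ) := isOpen_interior
  -- A fibre with at most one point lies in an open `U` on which `f` is injective. As `f` is closed,
  -- values near `c` are taken only inside `U`.
  have hcover : Dᶜ ⊆ B ∪ interior Bᶜ := by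
    intro c hc
    by_cases hcB : c ∈ B
    · exact .inl hcB
    refine .inr (mem_interior_iff_mem_nhds.mpr ?_)
    obtain ⟨U, hUo, hUc, hUi⟩ : ∃ U, IsOpen U ∧ f ⁻¹' {c} ⊆ U ∧ InjOn f U := by
      rcases (f ⁻¹' {c}).eq_empty_or_nonempty with h | ⟨x, hx⟩
      · exact ⟨∅, isOpen_empty, h.le, injOn_empty f⟩
      · obtain ⟨U, hU, hUi⟩ := hloc x (by rwa [show f x = c from hx])
        obtain ⟨V, hVU, hV, hxV⟩ := mem_nhds_iff.mp hU
        refine ⟨V, hV, fun y hy ↦ ?_, hUi.mono hVU⟩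
        by_contra hyV
        exact hcB ⟨x, y, fun h ↦ hyV (h ▸ hxV), hx, hy⟩
    have hcl : IsClosed (f '' Uᶜ) := hfc _ hUo.isClosed_compl
    have hcn : c ∉ f '' Uᶜ := fun ⟨x, hxU, hx⟩ ↦ hxU (hUc hx)
    filter_upwards [hcl.isOpen_compl.mem_nhds hcn]
    rintro d hd ⟨x, y, hxy, hx, hy⟩
    refine hxy (hUi ?_ ?_ (hx.trans hy.symm))
    · by_contra h
      exact hd ⟨x, h, hx⟩
    · by_contra h
      exact hd ⟨y, h, hy⟩
  have hconn : IsPreconnected Dᶜ :=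
    (hD.isConnected_compl_of_one_lt_rank (by simp)).isPreconnected
  have hc₀B : c₀ ∉ B := fun ⟨x, y, hxy, hx, hy⟩ ↦ hxy (hc₀' hx hy)
  have hBD : B ⊆ D := by
    intro c hcB
    by_contra hcD
    obtain ⟨d, -, hd, hd'⟩ := hconn B (interior Bᶜ) hBo hAo hcover ⟨c, hcD, hcB⟩
      ⟨c₀, hc₀, (hcover hc₀).resolve_left hc₀B⟩
    exact interior_subset hd' hd
  -- An open set inside a countable set is empty.
  have hBe : B = ∅ := by
    by_contra h
    have h2 : Dense Dᶜ := hD.dense_compl ℝ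
    obtain ⟨c, hc, hcB⟩ := h2.inter_open_nonempty B hBo (nonempty_iff_ne_empty.mpr h)
    exact hcB (hBD hc)
  intro x y hxy
  by_contra h
  exact (hBe ▸ (⟨x, y, h, rfl, hxy.symm⟩ : f x ∈ B) : f x ∈ (∅ : Set ℂ))

/-- Near a point where `f - f z₀` vanishes to order `m ≥ 1`, the function `f` takes some value at
least `m` times. -/
theorem exists_injective_forall_eq_of_analyticOrderAt {f : ℂ → ℂ} {z₀ : ℂ} {m : ℕ}
    (hf : AnalyticAt ℂ f z₀) (hm : analyticOrderAt (f · - f z₀) z₀ = m) (hm0 : m ≠ 0)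
    {U : Set ℂ} (hU : U ∈ 𝓝 z₀) :
    ∃ p : Fin m → ℂ, Function.Injective p ∧ (∀ i, p i ∈ U) ∧ ∀ i j, f (p i) = f (p j) := by
  obtain ⟨g, hg, hg0, hfg⟩ :=
    (AnalyticAt.analyticOrderAt_eq_natCast (f := (f · - f z₀)) (by fun_prop)).mp hm
  have hm0' : (m : ℂ) ≠ 0 := Nat.cast_ne_zero.mpr hm0
  -- An analytic `m`-th root of `g`: dividing by `g z₀` moves the base to `1`, away from the branch
  -- cut. Then `f - f z₀ = φ ^ m` with `φ` a local coordinate, and the required points are those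
  -- where `φ` is `ε / 2` times an `m`-th root of unity.
  set h : ℂ → ℂ := fun z ↦ g z₀ ^ (m : ℂ)⁻¹ * (g z / g z₀) ^ (m : ℂ)⁻¹ with hh
  have hhm : ∀ z, h z ^ m = g z := by
    intro z
    rw [hh, mul_pow, Complex.cpow_nat_inv_pow _ hm0, Complex.cpow_nat_inv_pow _ hm0,
      mul_div_cancel₀ _ hg0]
  have hha : AnalyticAt ℂ h z₀ := by
    refine analyticAt_const.mul (AnalyticAt.cpow (hg.div_const) analyticAt_const ?_)
    rw [div_self hg0]
    exact Complex.one_mem_slitPlane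
  have hh0 : h z₀ ≠ 0 := fun H ↦ hg0 (by rw [← hhm, H, zero_pow hm0])
  set φ : ℂ → ℂ := fun z ↦ (z - z₀) * h z with hφ
  have hφd : HasStrictDerivAt φ (h z₀) z₀ := by
    have h1 : HasStrictDerivAt (fun z : ℂ ↦ z - z₀) 1 z₀ := (hasStrictDerivAt_id z₀).sub_const z₀
    have h2 := h1.mul hha.hasStrictDerivAt
    simp only [one_mul, sub_self, zero_mul, add_zero] at h2
    exact h2
  have hmap := hφd.map_nhds_eq hh0
  have hW : U ∩ {z | f z - f z₀ = φ z ^ m} ∈ 𝓝 z₀ := by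
    filter_upwards [hU, hfg] with z hz hz'
    refine ⟨hz, ?_⟩
    simp only [mem_ofPred_eq]
    rw [hz', hφ, mul_pow, hhm, smul_eq_mul]
  have himg := image_mem_map (m := φ) hW
  rw [hmap, show φ z₀ = 0 by simp [hφ]] at himg
  obtain ⟨ε, hε, hball⟩ := Metric.mem_nhds_iff.mp himg
  have hζ := Complex.isPrimitiveRoot_exp m hm0
  set ζ := Complex.exp (2 * Real.pi * Complex.I / m)
  have hex : ∀ i : Fin m, ∃ z ∈ U ∩ {z | f z - f z₀ = φ z ^ m},
      φ z = (ε / 2 : ℝ) * ζ ^ (i : ℕ) := by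
    intro i
    refine hball ?_
    rw [mem_ball_zero_iff, norm_mul, norm_pow, hζ.norm'_eq_one hm0]
    simp only [Complex.norm_real, Real.norm_eq_abs, one_pow, mul_one]
    rw [abs_of_pos (by positivity)]
    linarith
  choose p hp hp' using hex
  have hval : ∀ i, f (p i) = f z₀ + ((ε / 2 : ℝ) : ℂ) ^ m := by
    intro i
    have h1 : f (p i) - f z₀ = φ (p i) ^ m := (hp i).2
    rw [hp', mul_pow, ← pow_mul, mul_comm (i : ℕ), pow_mul, hζ.pow_eq_one, one_pow, mul_one] at h1
    rw [← h1]
    ring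
  refine ⟨p, fun i j hij ↦ ?_, fun i ↦ (hp i).1, fun i j ↦ by rw [hval, hval]⟩
  have h1 := hp' i
  rw [hij, hp' j] at h1
  have hε2 : ((ε / 2 : ℝ) : ℂ) ≠ 0 := by exact_mod_cast (by positivity : ε / 2 ≠ 0)
  exact Fin.ext (hζ.pow_inj j.2 i.2 (mul_left_cancel₀ hε2 h1)).symm

end ValenceFormula

/-! ### The function `j`: invariance, cusp, critical points -/

namespace ValenceFormula
open Set Filter Topology UpperHalfPlane ModularForm
open scoped Manifold Modular

theorem analyticAt_comp_ofComplex {f : ℍ → ℂ} (hf : MDiff f) (τ : ℍ) :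
    AnalyticAt ℂ (f ∘ ofComplex) τ :=
  (UpperHalfPlane.mdifferentiable_iff.mp hf).analyticAt (isOpen_upperHalfPlaneSet.mem_nhds τ.im_pos)

/-- The elliptic modular function `j = E₄³ / Δ`. -/
noncomputable def kleinJ (τ : ℍ) : ℂ := E₄ τ ^ 3 / discriminant τ

theorem mdifferentiable_kleinJ : MDiff kleinJ := by
  have h1 : MDiff (E₄.pow 3 : ModularForm 𝒮ℒ _) := (E₄.pow 3).holo'
  have h2 := h1.div CuspForm.discriminant.holo' discriminant_ne_zero
  exact h2

theorem modularForm_smul {k : ℤ} (F : ModularForm 𝒮ℒ k) (γ : SL(2, ℤ)) (τ : ℍ) :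
    F (γ • τ) = denom γ τ ^ k * F τ :=
  SlashInvariantForm.slash_action_eqn'' F (γ := γ) (MonoidHom.mem_range.mpr ⟨γ, rfl⟩) τ

theorem discriminant_smul (γ : SL(2, ℤ)) (τ : ℍ) :
    discriminant (γ • τ) = denom γ τ ^ 12 * discriminant τ := by
  exact_mod_cast SlashInvariantForm.slash_action_eqn'' CuspForm.discriminant (γ := γ)
    (MonoidHom.mem_range.mpr ⟨γ, rfl⟩) τ

theorem kleinJ_smul (γ : SL(2, ℤ)) (τ : ℍ) : kleinJ (γ • τ) = kleinJ τ := by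
  have h := denom_ne_zero γ τ
  have h4 : E₄ (γ • τ) = denom γ τ ^ (4 : ℤ) * E₄ τ := modularForm_smul E₄ γ τ
  rw [kleinJ, kleinJ, discriminant_smul, h4]
  have := discriminant_ne_zero τ
  rw [mul_pow, show (denom γ τ ^ (4 : ℤ)) ^ 3 = denom γ τ ^ 12 by norm_cast; ring]
  field_simp

theorem discriminant_mul_kleinJ (τ : ℍ) : discriminant τ * kleinJ τ = E₄ τ ^ 3 :=
  mul_div_cancel₀ _ (discriminant_ne_zero τ)

theorem kleinJ_sub_eq (τ : ℍ) : kleinJ τ - 1728 = E₆ τ ^ 2 / discriminant τ := by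
  have := discriminant_ne_zero τ
  have h := discriminant_eq_E₄_cube_sub_E₆_sq τ
  rw [kleinJ]
  field_simp
  rw [h]
  ring

theorem cuspFunction_E₄_zero : cuspFunction 1 E₄ 0 = 1 := by
  have := EisensteinSeries.E_qExpansion_coeff_zero (k := 4) (by norm_num) ⟨2, rfl⟩
  simpa [qExpansion_coeff] using this

theorem analyticAt_cuspFunction {k : ℤ} (F : ModularForm 𝒮ℒ k) :
    AnalyticAt ℂ (cuspFunction 1 F) 0 :=
  ModularFormClass.analyticAt_cuspFunction_zero F one_pos one_mem_strictPeriods_SL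

theorem analyticAt_cuspFunction_discriminant : AnalyticAt ℂ (cuspFunction 1 discriminant) 0 :=
  ModularFormClass.analyticAt_cuspFunction_zero CuspForm.discriminant one_pos
    one_mem_strictPeriods_SL

theorem cuspFunction_discriminant_zero : cuspFunction 1 discriminant 0 = 0 :=
  CuspFormClass.cuspFunction_apply_zero CuspForm.discriminant one_pos one_mem_strictPeriods_SL

theorem deriv_cuspFunction_discriminant_zero : deriv (cuspFunction 1 discriminant) 0 = 1 := by
  simpa [qExpansion_coeff] using discriminant_qExpansion_coeff_one

/-- The function `1 / j` as a function of `q = exp (2 π i τ)`. -/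
noncomputable def invKleinJCusp (q : ℂ) : ℂ :=
  cuspFunction 1 discriminant q / cuspFunction 1 E₄ q ^ 3

theorem invKleinJCusp_qParam (τ : ℍ) :
    invKleinJCusp (Function.Periodic.qParam 1 τ) = (kleinJ τ)⁻¹ := by
  have h1 := SlashInvariantFormClass.eq_cuspFunction CuspForm.discriminant τ
    one_mem_strictPeriods_SL one_ne_zero
  have h2 := SlashInvariantFormClass.eq_cuspFunction E₄ τ one_mem_strictPeriods_SL one_ne_zero
  rw [CuspForm.coe_discriminant] at h1
  rw [invKleinJCusp, h1, h2, kleinJ, inv_div]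

theorem hasStrictDerivAt_invKleinJCusp : HasStrictDerivAt invKleinJCusp 1 0 := by
  have h1 := analyticAt_cuspFunction_discriminant.hasStrictDerivAt
  have h2 := ((analyticAt_cuspFunction E₄).pow 3).hasStrictDerivAt
  have h3 : (cuspFunction 1 E₄ ^ 3) 0 ≠ 0 := by simp [cuspFunction_E₄_zero]
  have h4 := h1.div h2 h3
  have h5 : (1 : ℂ) = (deriv (cuspFunction 1 discriminant) 0 * (cuspFunction 1 E₄ ^ 3) 0 -
      cuspFunction 1 discriminant 0 * deriv (cuspFunction 1 E₄ ^ 3) 0) /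
        (cuspFunction 1 E₄ ^ 3) 0 ^ 2 := by
    rw [deriv_cuspFunction_discriminant_zero, cuspFunction_discriminant_zero, Pi.pow_apply,
      cuspFunction_E₄_zero]
    simp
  rw [h5]
  exact h4

theorem exists_nhds_injOn_of_hasStrictDerivAt {f : ℂ → ℂ} {f' z : ℂ} (hf : HasStrictDerivAt f f' z)
    (hf' : f' ≠ 0) : ∃ U ∈ 𝓝 z, InjOn f U := by
  have h := hf.hasStrictFDerivAt_equiv hf'
  exact ⟨_, (h.toOpenPartialHomeomorph f).open_source.mem_nhds h.mem_toOpenPartialHomeomorph_source,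
    (h.toOpenPartialHomeomorph f).injOn⟩

/-- `1 / j` is a local coordinate at `q = 0`, so high in `ℍ` the value of `j` determines `q`, hence
`τ` up to integer translation. -/
theorem exists_forall_kleinJ_eq_imp : ∃ A : ℝ, ∀ τ σ : ℍ, A ≤ τ.im → A ≤ σ.im →
    kleinJ τ = kleinJ σ → ∃ γ : SL(2, ℤ), γ • σ = τ := by
  obtain ⟨U, hU, hinj⟩ := exists_nhds_injOn_of_hasStrictDerivAt hasStrictDerivAt_invKleinJCusp
    one_ne_zero
  obtain ⟨A, hA⟩ := (atImInfty_mem _).mp (qParam_tendsto_atImInfty one_pos hU)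
  refine ⟨A, fun τ σ hτ hσ h ↦ ?_⟩
  have h1 : Function.Periodic.qParam 1 τ = Function.Periodic.qParam 1 σ :=
    hinj (hA τ hτ) (hA σ hσ) (by rw [invKleinJCusp_qParam, invKleinJCusp_qParam, h])
  obtain ⟨m, hm⟩ := Function.Periodic.qParam_left_inv_mod_period (h := 1) one_ne_zero τ
  obtain ⟨n, hn⟩ := Function.Periodic.qParam_left_inv_mod_period (h := 1) one_ne_zero σ
  refine ⟨ModularGroup.T ^ (n - m), UpperHalfPlane.ext ?_⟩
  rw [ModularGroup.coe_T_zpow_smul_eq]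
  rw [h1, hn] at hm
  push_cast at hm ⊢
  linear_combination hm

theorem tendsto_norm_kleinJ : Tendsto (fun τ ↦ ‖kleinJ τ‖) atImInfty atTop := by
  have h1 : Tendsto (fun τ ↦ ‖E₄ τ ^ 3‖) atImInfty (𝓝 1) := by
    have h2 := ((analyticAt_cuspFunction E₄).continuousAt.tendsto.comp
      (qParam_tendsto_atImInfty one_pos)).congr fun τ ↦
        SlashInvariantFormClass.eq_cuspFunction E₄ τ one_mem_strictPeriods_SL one_ne_zero
    rw [cuspFunction_E₄_zero] at h2
    simpa using (h2.pow 3).norm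
  have h3 : Tendsto (fun τ ↦ ‖discriminant τ‖⁻¹) atImInfty atTop := by
    refine tendsto_inv_nhdsGT_zero.comp (tendsto_nhdsWithin_iff.mpr ⟨?_, ?_⟩)
    · simpa using! (show Tendsto discriminant atImInfty (𝓝 0) from discriminant_isZeroAtImInfty).norm
    · exact .of_forall fun τ ↦ norm_pos_iff.mpr (discriminant_ne_zero τ)
  refine (h1.pos_mul_atTop one_pos h3).congr fun τ ↦ ?_
  rw [kleinJ, norm_div, div_eq_mul_inv]

theorem analyticOnNhd_kleinJ : AnalyticOnNhd ℂ (kleinJ ∘ ofComplex) {z | 0 < z.im} :=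
  fun z hz ↦ analyticAt_comp_ofComplex mdifferentiable_kleinJ ⟨z, hz⟩

theorem not_forall_kleinJ_eq (c : ℂ) : ¬ ∀ τ, kleinJ τ = c := by
  intro h
  obtain ⟨A, hA⟩ := (atImInfty_mem _).mp (tendsto_norm_kleinJ.eventually_gt_atTop ‖c‖)
  have := hA ⟨⟨0, max A 1⟩, by simp⟩ (le_max_left _ _)
  simp [h] at this

theorem isPreconnected_im_pos : IsPreconnected {z : ℂ | 0 < z.im} :=
  (convex_halfSpace_im_gt 0).isPreconnected

theorem isOpenMap_kleinJ : IsOpenMap kleinJ := by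
  rcases analyticOnNhd_kleinJ.is_constant_or_isOpen isPreconnected_im_pos with ⟨w, hw⟩ | h
  · refine (not_forall_kleinJ_eq w fun τ ↦ ?_).elim
    simpa using hw τ τ.im_pos
  · intro s hs
    convert! h _ (image_subset_iff.mpr fun τ _ ↦ τ.im_pos) (isOpenEmbedding_coe.isOpenMap s hs)
    rw [image_image]
    simp

theorem countable_setOf_deriv_kleinJ_eq_zero :
    {z : ℂ | 0 < z.im ∧ deriv (kleinJ ∘ ofComplex) z = 0}.Countable := by
  obtain ⟨z, hz, hz'⟩ : ∃ z : ℂ, 0 < z.im ∧ deriv (kleinJ ∘ ofComplex) z ≠ 0 := by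
    by_contra! H
    obtain ⟨a, ha⟩ := isOpen_upperHalfPlaneSet.exists_is_const_of_deriv_eq_zero
      isPreconnected_im_pos analyticOnNhd_kleinJ.differentiableOn H
    exact not_forall_kleinJ_eq a fun τ ↦ by simpa using ha τ τ.im_pos
  have h := analyticOnNhd_kleinJ.deriv.preimage_zero_mem_codiscreteWithin hz' hz
    ⟨⟨z, hz⟩, isPreconnected_im_pos⟩
  refine (HereditarilyLindelofSpace.isLindelof _).countable_of_isDiscrete
    ((isDiscrete_of_codiscreteWithin (s := {z : ℂ | deriv (kleinJ ∘ ofComplex) z = 0})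
      ?_).mono fun z hz ↦ ⟨hz.2, hz.1⟩)
  exact h

end ValenceFormula

/-! ### Bijectivity of `j` on the quotient -/

namespace ValenceFormula
open Set Filter Topology UpperHalfPlane ModularForm
open scoped Manifold Modular

theorem kleinJ_smul_of_mem (γ : 𝒮ℒ) (τ : ℍ) : kleinJ (γ • τ) = kleinJ τ := by
  obtain ⟨_, g, rfl⟩ := γ
  exact kleinJ_smul g τ

/-- The function induced by `j` on the quotient of the upper half-plane by `SL(2, ℤ)`. -/
noncomputable def kleinJQuotient : Quotient (MulAction.orbitRel 𝒮ℒ ℍ) → ℂ :=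
  Quotient.lift kleinJ fun _ σ ⟨γ, hγ⟩ ↦ hγ ▸ kleinJ_smul_of_mem γ σ

theorem kleinJQuotient_mk (τ : ℍ) : kleinJQuotient (Quotient.mk _ τ) = kleinJ τ := rfl

theorem continuous_kleinJQuotient : Continuous kleinJQuotient :=
  continuous_quot_lift _ mdifferentiable_kleinJ.continuous

theorem isOpenMap_kleinJQuotient : IsOpenMap kleinJQuotient := by
  intro s hs
  have h := isOpenMap_kleinJ _ (hs.preimage (continuous_quotient_mk'))
  convert! h using 1
  ext c
  constructor
  · rintro ⟨x, hx, rfl⟩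
    obtain ⟨τ, rfl⟩ := Quotient.mk_surjective x
    exact ⟨τ, hx, rfl⟩
  · rintro ⟨τ, hτ, rfl⟩
    exact ⟨_, hτ, rfl⟩

/-- The map is proper: a bound on `|j|` bounds the height of representatives in `𝒟`, and the
truncated fundamental domain is compact. -/
theorem isClosedMap_kleinJQuotient : IsClosedMap kleinJQuotient := by
  refine (isProperMap_iff_isCompact_preimage.mpr
    ⟨continuous_kleinJQuotient, fun K hK ↦ ?_⟩).isClosedMap
  obtain ⟨R, hR⟩ := hK.isBounded.exists_norm_le
  obtain ⟨A, hA⟩ := (atImInfty_mem _).mp (tendsto_norm_kleinJ.eventually_gt_atTop R)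
  refine ((ModularGroup.isCompact_truncatedFundamentalDomain A).image
    (continuous_quotient_mk' (s := MulAction.orbitRel 𝒮ℒ ℍ))).of_isClosed_subset
    (hK.isClosed.preimage continuous_kleinJQuotient) ?_
  intro x hx
  obtain ⟨τ, rfl⟩ := Quotient.mk_surjective x
  obtain ⟨g, hg⟩ := ModularGroup.exists_smul_mem_fd τ
  refine ⟨g • τ, ⟨hg, ?_⟩, Quotient.sound ⟨⟨g, MonoidHom.mem_range.mpr ⟨g, rfl⟩⟩, rfl⟩⟩
  by_contra! hlt
  have h1 : R < ‖kleinJ (g • τ)‖ := hA _ hlt.le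
  rw [kleinJ_smul] at h1
  exact (hR _ hx).not_gt h1

theorem kleinJ_surjective : Function.Surjective kleinJ := by
  have h1 : IsClopen (range kleinJ) := by
    have : range kleinJ = range kleinJQuotient := by
      rw [← Quotient.mk_surjective.range_comp kleinJQuotient]
      rfl
    constructor
    · exact this ▸ isClosedMap_kleinJQuotient.isClosed_range
    · exact isOpenMap_kleinJ.isOpen_range
  exact range_eq_univ.mp (h1.eq_univ (range_nonempty _))

theorem kleinJQuotient_injective : Function.Injective kleinJQuotient := by
  set N := {z : ℂ | 0 < z.im ∧ deriv (kleinJ ∘ ofComplex) z = 0}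
  set D : Set ℂ := (kleinJ ∘ ofComplex) '' N with hDdef
  have hD : D.Countable := countable_setOf_deriv_kleinJ_eq_zero.image _
  obtain ⟨A, hA⟩ := exists_forall_kleinJ_eq_imp
  have hbdd : ∃ R : ℝ, ∀ τ ∈ 𝒟, R < ‖kleinJ τ‖ → A ≤ τ.im := by
    obtain ⟨R, hR⟩ := ((ModularGroup.isCompact_truncatedFundamentalDomain A).image
      mdifferentiable_kleinJ.continuous).isBounded.exists_norm_le
    refine ⟨R, fun τ hτ h ↦ ?_⟩
    by_contra! hlt
    exact (hR _ ⟨τ, ⟨hτ, hlt.le⟩, rfl⟩).not_gt h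
  obtain ⟨R, hR⟩ := hbdd
  -- A noncritical value so large that all its preimages in `𝒟` lie in the region where `j`
  -- separates orbits.
  obtain ⟨c₀, hc₀D, hc₀⟩ : ∃ c ∉ D, R < ‖c‖ := by
    have ho : IsOpen {c : ℂ | R < ‖c‖} := isOpen_lt continuous_const continuous_norm
    have hne : {c : ℂ | R < ‖c‖}.Nonempty := by
      refine ⟨((|R| + 1 : ℝ) : ℂ), ?_⟩
      rw [mem_ofPred_eq, Complex.norm_real, Real.norm_eq_abs, abs_of_pos (by positivity)]
      linarith [le_abs_self R]
    obtain ⟨c, hc, hcD⟩ := (hD.dense_compl ℝ).inter_open_nonempty _ ho hne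
    exact ⟨c, hcD, hc⟩
  refine injective_of_isOpenMap_of_isClosedMap isOpenMap_kleinJQuotient isClosedMap_kleinJQuotient
    hD ?_ hc₀D ?_
  · intro x hx
    obtain ⟨τ, rfl⟩ := Quotient.mk_surjective x
    rw [kleinJQuotient_mk] at hx
    have hd : deriv (kleinJ ∘ ofComplex) τ ≠ 0 := fun h ↦ hx ⟨τ, ⟨τ.im_pos, h⟩, by simp⟩
    obtain ⟨U, hU, hinj⟩ := exists_nhds_injOn_of_hasStrictDerivAt
      (analyticAt_comp_ofComplex mdifferentiable_kleinJ τ).hasStrictDerivAt hd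
    have hU' : UpperHalfPlane.coe ⁻¹' U ∈ 𝓝 τ := continuous_coe.continuousAt hU
    refine ⟨_, (isOpenMap_quotient_mk'_mul (Γ := 𝒮ℒ) (T := ℍ)).image_mem_nhds hU', ?_⟩
    rintro _ ⟨a, ha, rfl⟩ _ ⟨b, hb, rfl⟩ hab
    have : (a : ℂ) = b := hinj ha hb (by simpa using! hab)
    rw [UpperHalfPlane.ext this]
  · intro x hx y hy
    obtain ⟨τ, rfl⟩ := Quotient.mk_surjective x
    obtain ⟨σ, rfl⟩ := Quotient.mk_surjective y
    obtain ⟨g, hg⟩ := ModularGroup.exists_smul_mem_fd τ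
    obtain ⟨h, hh⟩ := ModularGroup.exists_smul_mem_fd σ
    have h1 : kleinJ (g • τ) = c₀ := (kleinJ_smul g τ).trans hx
    have h2 : kleinJ (h • σ) = c₀ := (kleinJ_smul h σ).trans hy
    obtain ⟨γ, hγ⟩ := hA (g • τ) (h • σ) (hR _ hg (h1 ▸ hc₀)) (hR _ hh (h2 ▸ hc₀)) (h1.trans h2.symm)
    refine Quotient.sound ⟨⟨(g⁻¹ * γ * h : SL(2, ℤ)), MonoidHom.mem_range.mpr ⟨_, rfl⟩⟩, ?_⟩
    change (g⁻¹ * γ * h) • σ = τ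
    rw [mul_smul, mul_smul, hγ, inv_smul_smul]

theorem exists_smul_eq_of_kleinJ_eq {τ σ : ℍ} (h : kleinJ τ = kleinJ σ) :
    ∃ γ : SL(2, ℤ), γ • σ = τ := by
  obtain ⟨⟨_, g, rfl⟩, hg⟩ := Quotient.exact (kleinJQuotient_injective (a₁ := ⟦τ⟧) (a₂ := ⟦σ⟧) h)
  exact ⟨g, hg⟩

end ValenceFormula

/-! ### The strict fundamental domain and the ramification of `j` -/

namespace ValenceFormula
open Set Filter Topology UpperHalfPlane ModularForm
open scoped Manifold Modular

theorem fundDomain_subset_fd : fundDomain ⊆ 𝒟 := by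
  rintro τ ⟨h1, h2, h3, -⟩
  refine ⟨?_, abs_le.mpr ⟨h1, h2.le⟩⟩
  rw [Complex.normSq_eq_norm_sq]
  exact one_le_pow₀ h3

theorem re_S_smul (τ : ℍ) (h : ‖(τ : ℂ)‖ = 1) : (ModularGroup.S • τ).re = -τ.re := by
  rw [modular_S_smul, ← coe_re, coe_mk, Complex.inv_re, Complex.normSq_neg,
    Complex.normSq_eq_norm_sq, h]
  simp

theorem norm_S_smul (τ : ℍ) : ‖((ModularGroup.S • τ : ℍ) : ℂ)‖ = ‖(τ : ℂ)‖⁻¹ := by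
  rw [modular_S_smul, coe_mk, norm_inv, norm_neg]

/-- Starting from the closed domain `𝒟`, `T⁻¹` moves the right edge to the left one and `S` reflects
the right half of the arc. -/
theorem exists_smul_mem_fundDomain (τ : ℍ) : ∃ γ : SL(2, ℤ), γ • τ ∈ fundDomain := by
  obtain ⟨g, hn, hre⟩ := ModularGroup.exists_smul_mem_fd τ
  have hn' : 1 ≤ ‖((g • τ : ℍ) : ℂ)‖ := by
    rw [Complex.normSq_eq_norm_sq] at hn
    exact (one_le_sq_iff₀ (norm_nonneg _)).mp hn
  obtain ⟨h1, h2⟩ := abs_le.mp hre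
  rcases h2.lt_or_eq with h2 | h2
  · by_cases h : ‖((g • τ : ℍ) : ℂ)‖ = 1 ∧ 0 < (g • τ).re
    · refine ⟨ModularGroup.S * g, ?_⟩
      rw [mul_smul]
      have h3 := re_S_smul _ h.1
      have h4 := norm_S_smul (g • τ)
      rw [h.1, inv_one] at h4
      refine ⟨?_, ?_, h4.ge, fun _ ↦ ?_⟩ <;> rw [h3] <;> linarith [h.2]
    · exact ⟨g, h1, h2, hn', fun h3 ↦ not_lt.mp fun h4 ↦ h ⟨h3, h4⟩⟩
  · refine ⟨ModularGroup.T⁻¹ * g, ?_⟩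
    rw [mul_smul]
    have h3 := ModularGroup.re_T_inv_smul (g • τ)
    have h4 := ModularGroup.im_T_inv_smul (g • τ)
    have h5 : ‖((ModularGroup.T⁻¹ • g • τ : ℍ) : ℂ)‖ = ‖((g • τ : ℍ) : ℂ)‖ := by
      rw [← sq_eq_sq₀ (norm_nonneg _) (norm_nonneg _), ← Complex.normSq_eq_norm_sq,
        ← Complex.normSq_eq_norm_sq, Complex.normSq_apply, Complex.normSq_apply]
      simp only [coe_re, coe_im]
      rw [h3, h4, h2]
      ring
    refine ⟨?_, ?_, h5.ge.trans' hn', fun _ ↦ ?_⟩ <;> rw [h3, h2] <;> norm_num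

theorem eq_of_smul_eq_of_mem_fundDomain {τ σ : ℍ} (hτ : τ ∈ fundDomain) (hσ : σ ∈ fundDomain)
    {γ : SL(2, ℤ)} (h : γ • σ = τ) : σ = τ := by
  have hρ : ((1 : ℝ) +ᵥ ρ).re = 1 / 2 := by
    rw [vadd_re]
    norm_num [ρ]
  have hST : (ModularGroup.S * ModularGroup.T) • ρ = ρ := by
    rw [ModularGroup.stabilizer_ρ]
    simp
  have hTS : (ModularGroup.T⁻¹ * ModularGroup.S) • ρ = ρ := by
    rw [ModularGroup.stabilizer_ρ]
    simp
  have hfd : γ • σ ∈ 𝒟 := h ▸ fundDomain_subset_fd hτ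
  subst h
  obtain ⟨h1, h2, h3, h4⟩ := hτ
  obtain ⟨k1, k2, k3, k4⟩ := id hσ
  rcases ModularGroup.cases_of_mem_fd_smul_mem_fd (fundDomain_subset_fd hσ) hfd with
    (rfl | rfl) | ⟨rfl | rfl, hz⟩ | ⟨-, hz⟩ | ⟨rfl | rfl, hz⟩ | ⟨-, hz⟩ | ⟨-, hz⟩ | ⟨-, hz⟩ |
    ⟨rfl | rfl, hz⟩ | ⟨rfl | rfl, hz⟩ | ⟨rfl | rfl, hz⟩
  all_goals try rw [ModularGroup.SL_neg_smul] at *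
  all_goals try subst hz
  all_goals try rw [hST]
  all_goals try rw [hTS]
  all_goals try rw [one_smul]
  all_goals try linarith
  all_goals try (rw [ModularGroup.re_T_smul] at h2; linarith)
  all_goals try (rw [mul_assoc, mul_smul, hST, ModularGroup.re_T_smul] at h2; norm_num [ρ] at h2)
  -- What survives is `γ = ±S` on the unit circle. Both real parts are nonpositive and they are
  -- opposite, so `σ = i`, which `S` fixes.
  all_goals
    rw [norm_S_smul, hz, inv_one, re_S_smul _ hz] at h4
    have h5 : σ.re = 0 := le_antisymm (k4 hz) (by linarith [h4 rfl])
    have h6 : σ = I := by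
      have h7 : Complex.normSq σ = 1 := by rw [Complex.normSq_eq_norm_sq, hz, one_pow]
      rw [Complex.normSq_apply, coe_re, coe_im, h5] at h7
      have h8 : σ.im = 1 := by nlinarith [σ.im_pos]
      exact UpperHalfPlane.ext (Complex.ext (by simpa using h5) (by simpa using h8))
    rw [h6, eq_comm, ModularGroup.stabilizer_I]
    simp

theorem bijOn_kleinJ_fundDomain : BijOn kleinJ fundDomain univ := by
  refine ⟨mapsTo_univ _ _, fun τ hτ σ hσ h ↦ ?_, fun c _ ↦ ?_⟩
  · obtain ⟨γ, hγ⟩ := exists_smul_eq_of_kleinJ_eq h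
    exact (eq_of_smul_eq_of_mem_fundDomain hτ hσ hγ).symm
  · obtain ⟨τ, rfl⟩ := kleinJ_surjective c
    obtain ⟨γ, hγ⟩ := exists_smul_mem_fundDomain τ
    exact ⟨_, hγ, kleinJ_smul γ τ⟩

/-- The stabilizer of `τ` modulo `±1` has order `e_τ`, so it moves `z` to at most that many points.
-/
theorem exists_finset_card_le_ellipticWeight {τ : ℍ} (hτ : τ ∈ fundDomain) (z : ℍ) :
    ∃ s : Finset ℍ, s.card ≤ ellipticWeight τ ∧ ∀ γ : SL(2, ℤ), γ • τ = τ → γ • z ∈ s := by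
  classical
  unfold ellipticWeight
  split_ifs with hI hρ
  · subst hI
    refine ⟨{z, ModularGroup.S • z}, Finset.card_le_two, fun γ hγ ↦ ?_⟩
    rw [ModularGroup.stabilizer_I] at hγ
    simp only [Finset.mem_insert, Finset.mem_singleton] at hγ ⊢
    rcases hγ with rfl | rfl | rfl | rfl <;> simp [-ModularGroup.sl_moeb]
  · subst hρ
    refine ⟨{z, (ModularGroup.S * ModularGroup.T) • z, (ModularGroup.T⁻¹ * ModularGroup.S) • z},
      Finset.card_le_three, fun γ hγ ↦ ?_⟩
    rw [ModularGroup.stabilizer_ρ] at hγ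
    simp only [Finset.mem_insert, Finset.mem_singleton] at hγ ⊢
    rcases hγ with rfl | rfl | rfl | rfl | rfl | rfl <;> simp [-ModularGroup.sl_moeb]
  · refine ⟨{z}, by simp, fun γ hγ ↦ ?_⟩
    have h1 : τ ≠ (1 : ℝ) +ᵥ ρ := by
      rintro rfl
      have := hτ.2.1
      rw [vadd_re] at this
      norm_num [ρ] at this
    rcases ModularGroup.stabilizer_of_ne (fundDomain_subset_fd hτ) hγ hI hρ h1 with rfl | rfl <;>
      simp [-ModularGroup.sl_moeb]

/-- `S` fixes `i` with automorphy factor `i ^ 6 = -1`. -/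
theorem E₆_I : E₆ I = 0 := by
  have h1 : ModularGroup.S • I = I := by
    rw [ModularGroup.stabilizer_I]
    simp
  have h2 : E₆ (ModularGroup.S • I) = denom ModularGroup.S I ^ (6 : ℤ) * E₆ I :=
    modularForm_smul E₆ ModularGroup.S I
  rw [h1, ModularGroup.denom_S, coe_I, show Complex.I ^ (6 : ℤ) = -1 by
    rw [show (6 : ℤ) = ((6 : ℕ) : ℤ) by rfl, zpow_natCast]
    linear_combination (Complex.I ^ 4 - Complex.I ^ 2 + 1) * Complex.I_sq] at h2
  linear_combination h2 / 2

/-- `S T` fixes `ρ` with automorphy factor `(ρ + 1) ^ 4 = ρ ^ 2`, which is not `1`. -/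
theorem E₄_ρ : E₄ ρ = 0 := by
  have h1 : (ModularGroup.S * ModularGroup.T) • ρ = ρ := by
    rw [ModularGroup.stabilizer_ρ]
    simp
  have h2 : E₄ ((ModularGroup.S * ModularGroup.T) • ρ) =
      denom (ModularGroup.S * ModularGroup.T : SL(2, ℤ)) ρ ^ (4 : ℤ) * E₄ ρ :=
    modularForm_smul E₄ _ ρ
  have h3 : denom (ModularGroup.S * ModularGroup.T : SL(2, ℤ)) ρ = ρ + 1 := by
    have h : ((ModularGroup.S * ModularGroup.T : SL(2, ℤ)) : Matrix (Fin 2) (Fin 2) ℤ) =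
        !![0, -1; 1, 1] := by
      rw [Matrix.SpecialLinearGroup.coe_mul, ModularGroup.coe_S, ModularGroup.coe_T]
      simp
    rw [ModularGroup.denom_apply, h]
    simp
  have h4 : ((ρ : ℂ) + 1) ^ (4 : ℤ) = -ρ - 1 := by
    rw [show (4 : ℤ) = ((4 : ℕ) : ℤ) by rfl, zpow_natCast]
    linear_combination (ρ ^ 2 + 3 * ρ + 2 : ℂ) * ρ_sq
  rw [h1, h3, h4] at h2
  have h5 : (ρ : ℂ) + 2 ≠ 0 := fun h ↦ by
    have := congrArg Complex.im h
    simp [ρ] at this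
  have h6 : ((ρ : ℂ) + 2) * E₄ ρ = 0 := by linear_combination h2
  exact (mul_eq_zero.mp h6).resolve_left h5

theorem le_analyticOrderAt_pow_div_discriminant {k : ℤ} (F : ModularForm 𝒮ℒ k) {τ : ℍ}
    (hF : F τ = 0) (n : ℕ) :
    (n : ℕ∞) ≤ analyticOrderAt ((fun z ↦ F z ^ n / discriminant z) ∘ ofComplex) τ := by
  have h1 : AnalyticAt ℂ (F ∘ ofComplex) τ := analyticAt_comp_ofComplex F.holo' τ
  have h2 : AnalyticAt ℂ (CuspForm.discriminant ∘ ofComplex)⁻¹ τ :=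
    (analyticAt_comp_ofComplex CuspForm.discriminant.holo' τ).inv
      (by simpa using! discriminant_ne_zero τ)
  have h3 : (1 : ℕ∞) ≤ analyticOrderAt (F ∘ ofComplex) τ := by
    rw [Order.one_le_iff_ne_zero, h1.analyticOrderAt_ne_zero]
    simpa using hF
  have h4 : ((fun z ↦ F z ^ n / discriminant z) ∘ ofComplex) =
      (F ∘ ofComplex) ^ n * (CuspForm.discriminant ∘ ofComplex)⁻¹ := by
    ext z
    simp [div_eq_mul_inv]
  rw [h4, analyticOrderAt_mul (h1.pow n) h2, analyticOrderAt_pow h1, nsmul_eq_mul]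
  calc (n : ℕ∞) = n * 1 + 0 := by simp
    _ ≤ _ := add_le_add (mul_le_mul_right h3 _) zero_le

theorem analyticOrderAt_kleinJ_sub_ne_top (τ : ℍ) :
    analyticOrderAt (fun z ↦ (kleinJ ∘ ofComplex) z - (kleinJ ∘ ofComplex) τ) τ ≠ ⊤ := by
  rw [Ne, analyticOrderAt_eq_top]
  intro h
  have h1 := analyticOnNhd_kleinJ.eqOn_of_preconnected_of_eventuallyEq
    (g := fun _ ↦ kleinJ τ) analyticOnNhd_const isPreconnected_im_pos τ.im_pos
    (h.mono fun z hz ↦ by simpa using sub_eq_zero.mp hz)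
  exact not_forall_kleinJ_eq (kleinJ τ) fun σ ↦ by simpa using h1 σ.im_pos

/-- The zeros of `E₆` at `i` and `E₄` at `ρ` enter `j - 1728 = E₆² / Δ` and `j = E₄³ / Δ` squared
and cubed. -/
theorem ellipticWeight_le_analyticOrderAt_kleinJ (τ : ℍ) :
    (ellipticWeight τ : ℕ∞) ≤
      analyticOrderAt (fun z ↦ (kleinJ ∘ ofComplex) z - (kleinJ ∘ ofComplex) τ) τ := by
  unfold ellipticWeight
  split_ifs with hI hρ
  · subst hI
    have h := le_analyticOrderAt_pow_div_discriminant E₆ E₆_I 2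
    simp_rw [← kleinJ_sub_eq] at h
    have h0 : kleinJ I = 1728 := by
      rw [← sub_eq_zero, kleinJ_sub_eq, E₆_I]
      simp
    simp only [Function.comp_apply, ofComplex_apply, h0]
    exact h
  · subst hρ
    have h := le_analyticOrderAt_pow_div_discriminant E₄ E₄_ρ 3
    have h0 : kleinJ ρ = 0 := by rw [kleinJ, E₄_ρ]; simp
    simpa [h0, Function.comp_def] using! h
  · rw [Nat.cast_one, Order.one_le_iff_ne_zero, AnalyticAt.analyticOrderAt_ne_zero]
    · simp
    · exact (analyticAt_comp_ofComplex mdifferentiable_kleinJ τ).sub analyticAt_const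

/-- For the upper bound, order `m` yields `m` distinct points near `τ` with the same `j`. They share
an orbit, and by proper discontinuity the elements relating them fix `τ`, so `m ≤ e_τ`. -/
theorem analyticOrderAt_kleinJ {τ : ℍ} (hτ : τ ∈ fundDomain) :
    analyticOrderAt (fun z ↦ (kleinJ ∘ ofComplex) z - (kleinJ ∘ ofComplex) τ) τ =
      ellipticWeight τ := by
  refine le_antisymm ?_ (ellipticWeight_le_analyticOrderAt_kleinJ τ)
  obtain ⟨m, hm⟩ := ENat.ne_top_iff_exists.mp (analyticOrderAt_kleinJ_sub_ne_top τ)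
  rw [← hm, Nat.cast_le]
  rcases eq_or_ne m 0 with rfl | hm0
  · exact zero_le
  obtain ⟨U, hU, hUγ⟩ := ProperlyDiscontinuousSMul.exists_nhds_image_smul_eq_self 𝒮ℒ τ
  obtain ⟨p, hp, hpU, hpj⟩ := exists_injective_forall_eq_of_analyticOrderAt
    (analyticAt_comp_ofComplex mdifferentiable_kleinJ τ) hm.symm hm0
    (isOpenEmbedding_coe.image_mem_nhds.mpr hU)
  choose u hu hup using hpU
  have hju : ∀ i j, kleinJ (u i) = kleinJ (u j) := fun i j ↦ by
    simpa [← hup] using hpj i j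
  obtain ⟨s, hs, hsγ⟩ := exists_finset_card_le_ellipticWeight hτ (u ⟨0, Nat.pos_of_ne_zero hm0⟩)
  have hus : ∀ i, u i ∈ s := by
    intro i
    obtain ⟨γ, hγ⟩ := exists_smul_eq_of_kleinJ_eq (hju i ⟨0, Nat.pos_of_ne_zero hm0⟩)
    rw [← hγ]
    refine hsγ γ (hUγ ⟨γ, MonoidHom.mem_range.mpr ⟨γ, rfl⟩⟩ ⟨u i, ⟨_, hu _, hγ⟩, hu i⟩)
  have huinj : Function.Injective u := fun i j hij ↦ hp (by rw [← hup, ← hup, hij])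
  calc m = (Finset.univ : Finset (Fin m)).card := by simp
    _ ≤ s.card := Finset.card_le_card_of_injOn u (fun i _ ↦ hus i) huinj.injOn
    _ ≤ _ := hs

end ValenceFormula

/-! ### Forms of weight `12 n` as `Δ ^ n` times a polynomial in `j` -/

namespace ValenceFormula
open Set Filter Topology UpperHalfPlane ModularForm Polynomial
open scoped Manifold Modular

theorem orderAtInfty_mul {k l : ℤ} (F : ModularForm 𝒮ℒ k) (G : ModularForm 𝒮ℒ l) :
    orderAtInfty (F * G : ℍ → ℂ) = orderAtInfty F + orderAtInfty G := by
  have hF := analyticAt_cuspFunction F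
  have hG := analyticAt_cuspFunction G
  rw [orderAtInfty, cuspFunction_mul hF.continuousAt hG.continuousAt, analyticOrderAt_mul hF hG]
  rfl

theorem orderAtInfty_discriminant : orderAtInfty discriminant = 1 := by
  have h := analyticAt_cuspFunction_discriminant
  have h1 := h.analyticOrderAt_sub_eq_one_of_deriv_ne_zero
    (by rw [deriv_cuspFunction_discriminant_zero]; exact one_ne_zero)
  simpa [cuspFunction_discriminant_zero] using! h1

theorem orderAtInfty_discriminant_mul {k : ℤ} (F : ModularForm 𝒮ℒ k) :
    orderAtInfty (discriminant * F : ℍ → ℂ) = 1 + orderAtInfty F := by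
  have hF := analyticAt_cuspFunction F
  have hG := analyticAt_cuspFunction_discriminant
  rw [orderAtInfty, cuspFunction_mul hG.continuousAt hF.continuousAt, analyticOrderAt_mul hG hF]
  exact congrArg (· + _) orderAtInfty_discriminant

theorem orderAtInfty_eq_zero {k : ℤ} (F : ModularForm 𝒮ℒ k) (hF : (qExpansion 1 F).coeff 0 ≠ 0) :
    orderAtInfty F = 0 := by
  rw [orderAtInfty, (analyticAt_cuspFunction F).analyticOrderAt_eq_zero]
  simpa [qExpansion_coeff] using hF

/-- `E₄ ^ (3 n)` has weight `12 n` and constant term `1`. Subtracting the right multiple leaves a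
cusp form, which is divisible by `Δ`. -/
theorem exists_eq_smul_add_discriminant_mul {k : ℤ} {n : ℕ} (hk : k = 12 * n)
    (G : ModularForm 𝒮ℒ k) : ∃ f : ModularForm 𝒮ℒ (k - 12), ∀ τ,
      G τ = (qExpansion 1 G).coeff 0 * E₄ τ ^ (3 * n) + discriminant τ * f τ := by
  set H : ModularForm 𝒮ℒ k := ModularForm.mcast (by rw [hk]; push_cast; ring) (E₄.pow (3 * n))
    with hHdef
  have hH : ∀ τ, H τ = E₄ τ ^ (3 * n) := fun τ ↦ by
    simp only [hHdef, coe_mcast, ModularForm.coe_pow, Pi.pow_apply]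
  have hH0 : (qExpansion 1 H).coeff 0 = 1 := by
    rw [hHdef, ModularForm.qExpansion_mcast,
      ModularForm.qExpansion_pow one_pos one_mem_strictPeriods_SL]
    have := EisensteinSeries.E_qExpansion_coeff_zero (k := 4) (by norm_num) ⟨2, rfl⟩
    rw [PowerSeries.coeff_zero_eq_constantCoeff] at this ⊢
    rw [map_pow, this, one_pow]
  have h := (isCuspForm_iff_coeffZero_eq_zero _).mp (sub_smul_isCuspForm G H hH0)
  refine ⟨CuspForm.discriminantEquiv (toCuspForm _ h), fun τ ↦ ?_⟩
  rw [discriminant_mul_discriminantEquiv_apply, toCuspForm_apply, ← hH]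
  simp

theorem orderAtInfty_pow {k : ℤ} (F : ModularForm 𝒮ℒ k) (n : ℕ) :
    orderAtInfty (F.pow n) = n * orderAtInfty F := by
  induction n with
  | zero =>
    rw [orderAtInfty_eq_zero, Nat.cast_zero, zero_mul]
    rw [ModularForm.qExpansion_pow one_pos one_mem_strictPeriods_SL]
    simp
  | succ n ih =>
    rw [ModularForm.coe_pow, pow_succ, ← ModularForm.coe_pow, orderAtInfty_mul, ih,
      Nat.cast_succ, add_mul, one_mul]

/-- A modular form of level one and weight `12 n` is `Δ ^ n` times a polynomial in `j` of degree
at most `n`. The degree drops by the order of vanishing at the cusp. -/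
theorem exists_polynomial_kleinJ (n : ℕ) : ∀ {k : ℤ} (_ : k = 12 * n) (G : ModularForm 𝒮ℒ k),
    ∃ P : ℂ[X], P.natDegree ≤ n ∧ (∀ τ, G τ = discriminant τ ^ n * P.eval (kleinJ τ)) ∧
      (G ≠ 0 → orderAtInfty G + P.natDegree = n) := by
  induction n with
  | zero =>
    intro k hk G
    obtain ⟨f, hf⟩ := exists_eq_smul_add_discriminant_mul hk G
    -- The quotient has weight `-12`.
    have hf0 : ⇑f = 0 := ModularFormClass.levelOne_neg_weight_eq_zero (by simp [hk]) f
    refine ⟨C ((qExpansion 1 G).coeff 0), by simp, fun τ ↦ ?_, fun hG ↦ ?_⟩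
    · rw [hf, hf0]
      simp
    · rw [orderAtInfty_eq_zero G]
      · simp
      · intro h0
        refine hG (ModularForm.ext fun τ ↦ ?_)
        rw [hf, hf0, h0]
        simp
  | succ n ih =>
    intro k hk G
    obtain ⟨f, hf⟩ := exists_eq_smul_add_discriminant_mul hk G
    obtain ⟨P, hP, hPf, hPo⟩ := ih (by rw [hk]; push_cast; ring) f
    set a := (qExpansion 1 G).coeff 0 with ha
    have heval : ∀ τ, G τ = discriminant τ ^ (n + 1) * (C a * X ^ (n + 1) + P).eval (kleinJ τ) := by
      intro τ
      rw [hf, hPf, pow_mul, ← discriminant_mul_kleinJ]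
      simp only [eval_add, eval_mul, eval_C, eval_pow, eval_X]
      ring
    -- If `a = 0`, the polynomial is unchanged and the factor `Δ` adds one to the order at the cusp.
    -- Otherwise that order is `0` and `a` is the leading coefficient in degree `n + 1`.
    by_cases h0 : a = 0
    · refine ⟨P, hP.trans n.le_succ, fun τ ↦ by simpa [h0] using heval τ, fun hG ↦ ?_⟩
      have hG' : ⇑G = discriminant * ⇑f := by
        ext τ
        simpa [h0] using hf τ
      have hf0 : f ≠ 0 := by
        rintro rfl
        exact hG (ModularForm.ext fun τ ↦ by simp [hG'])
      rw [hG', orderAtInfty_discriminant_mul, add_assoc, hPo hf0, add_comm]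
      rfl
    · have hdeg : (C a * X ^ (n + 1) + P).natDegree = n + 1 := by
        rw [natDegree_add_eq_left_of_natDegree_lt, natDegree_C_mul_X_pow _ _ h0]
        rw [natDegree_C_mul_X_pow _ _ h0]
        lia
      refine ⟨_, hdeg.le, heval, fun _ ↦ ?_⟩
      rw [hdeg, orderAtInfty_eq_zero G h0, zero_add]

theorem analyticOrderAt_eval {P : ℂ[X]} (hP : P ≠ 0) (c : ℂ) :
    analyticOrderAt (fun z ↦ P.eval z) c = P.rootMultiplicity c := by
  obtain ⟨Q, hQ, hdvd⟩ := exists_eq_pow_rootMultiplicity_mul_and_not_dvd P hP c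
  have hana : AnalyticAt ℂ (fun z ↦ P.eval z) c :=
    P.differentiable.analyticAt c
  rw [hana.analyticOrderAt_eq_natCast]
  refine ⟨fun z ↦ Q.eval z, Q.differentiable.analyticAt c, fun h ↦ hdvd (dvd_iff_isRoot.mpr h),
    .of_forall fun z ↦ ?_⟩
  conv_lhs => rw [hQ]
  simp

theorem orderAt_pow {F : ℍ → ℂ} (hF : MDiff F) (n : ℕ) (τ : ℍ) :
    orderAt (F ^ n) τ = n * orderAt F τ := by
  have h := analyticOrderAt_pow (analyticAt_comp_ofComplex hF τ) n
  rw [nsmul_eq_mul] at h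
  exact h

theorem orderAt_eq_rootMultiplicity_mul {G : ℍ → ℂ} {n : ℕ} {P : ℂ[X]} (hP : P ≠ 0)
    (hG : ∀ τ, G τ = discriminant τ ^ n * P.eval (kleinJ τ)) (τ : ℍ) :
    orderAt G τ = P.rootMultiplicity (kleinJ τ) *
      analyticOrderAt (fun z ↦ (kleinJ ∘ ofComplex) z - (kleinJ ∘ ofComplex) τ) τ := by
  have hj := analyticAt_comp_ofComplex mdifferentiable_kleinJ τ
  have hΔ : AnalyticAt ℂ (discriminant ∘ ofComplex) τ :=
    analyticAt_comp_ofComplex CuspForm.discriminant.holo' τ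
  have hPa : AnalyticAt ℂ (fun z ↦ P.eval z) ((kleinJ ∘ ofComplex) τ) :=
    P.differentiable.analyticAt _
  have h : G ∘ ofComplex =
      (discriminant ∘ ofComplex) ^ n * ((fun z ↦ P.eval z) ∘ (kleinJ ∘ ofComplex)) := by
    ext z
    simp [hG]
  have hΔ0 : analyticOrderAt ((discriminant ∘ ofComplex) ^ n) (τ : ℂ) = 0 := by
    rw [(hΔ.pow n).analyticOrderAt_eq_zero]
    simp [discriminant_ne_zero]
  rw [orderAt, h, analyticOrderAt_mul (hΔ.pow n) (hPa.comp hj), hΔ0, zero_add,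
    hPa.analyticOrderAt_comp hj, analyticOrderAt_eval hP]
  simp

theorem finsum_rootMultiplicity (P : ℂ[X]) :
    ∑ᶠ c ∈ (univ : Set ℂ), (P.rootMultiplicity c : ℚ) = P.natDegree := by
  rw [finsum_mem_univ, finsum_eq_sum_of_support_subset (s := P.roots.toFinset)]
  · simp_rw [← count_roots]
    rw [← Nat.cast_sum, Multiset.toFinset_sum_count_eq, IsAlgClosed.card_roots_eq_natDegree]
  · intro c hc
    simpa [← count_roots, Multiset.count_eq_zero] using hc

/-- The twelfth power makes the weight a multiple of `12` whatever `k` is, and multiplies every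
order by `12`. -/
theorem exists_rootMultiplicity_eq_orderAt {k : ℤ} (F : ModularForm 𝒮ℒ k) (hF : F ≠ 0) :
    ∃ P : ℂ[X], P ≠ 0 ∧ (12 * orderAtInfty F + P.natDegree : ℕ∞) = k.toNat ∧ 0 ≤ k ∧
      ∀ τ, 12 * orderAt F τ = P.rootMultiplicity (kleinJ τ) *
        analyticOrderAt (fun z ↦ (kleinJ ∘ ofComplex) z - (kleinJ ∘ ofComplex) τ) τ := by
  have hk : 0 ≤ k := by
    by_contra! hk
    exact hF (ModularForm.ext (congrFun (ModularFormClass.levelOne_neg_weight_eq_zero hk F)))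
  lift k to ℕ using hk
  obtain ⟨P, -, hPe, hPo⟩ := exists_polynomial_kleinJ k (by push_cast; rfl) (F.pow 12)
  have hG0 : F.pow 12 ≠ 0 := by
    intro h
    have h1 : (⇑F) ^ 12 = 0 := by rw [← ModularForm.coe_pow, h]; rfl
    exact hF (ModularForm.ext fun τ ↦ pow_eq_zero_iff (n := 12) (by norm_num) |>.mp (congrFun h1 τ))
  have hP : P ≠ 0 := by
    rintro rfl
    exact hG0 (ModularForm.ext fun τ ↦ by rw [hPe]; simp)
  refine ⟨P, hP, ?_, by positivity, fun τ ↦ ?_⟩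
  · have h := hPo hG0
    rw [orderAtInfty_pow] at h
    exact_mod_cast h
  · rw [← orderAt_eq_rootMultiplicity_mul hP hPe, ModularForm.coe_pow]
    exact (orderAt_pow F.holo' 12 τ).symm

end ValenceFormula

/-! ### The valence formula -/

theorem mainTheorem1 (k : ℤ) (F : ModularForm 𝒮ℒ k) (hF : F ≠ 0) :
    (∀ τ : UpperHalfPlane, ValenceFormula.orderAt F τ ≠ ⊤) ∧
    ValenceFormula.orderAtInfty F ≠ ⊤ ∧
    {τ ∈ ValenceFormula.fundDomain | ValenceFormula.orderAt F τ ≠ 0}.Finite ∧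
    ((ValenceFormula.orderAtInfty F).toNat : ℚ) +
        ∑ᶠ τ ∈ ValenceFormula.fundDomain,
          ((ValenceFormula.orderAt F τ).toNat : ℚ) / (ValenceFormula.ellipticWeight τ : ℚ) =
      (k : ℚ) / 12 := by
  open ValenceFormula in
  obtain ⟨P, hP, hPinf, hk, hPτ⟩ := exists_rootMultiplicity_eq_orderAt F hF
  have htop : ∀ τ, orderAt F τ ≠ ⊤ := by
    intro τ h
    obtain ⟨m, hm⟩ := ENat.ne_top_iff_exists.mp (analyticOrderAt_kleinJ_sub_ne_top τ)
    have h1 := hPτ τ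
    rw [h, ← hm, ENat.mul_top (by norm_num)] at h1
    exact ENat.natCast_ne_top (P.rootMultiplicity (kleinJ τ) * m) (by exact_mod_cast h1.symm)
  have hinf : orderAtInfty F ≠ ⊤ := by
    intro h
    rw [h, ENat.mul_top (by norm_num), top_add] at hPinf
    exact ENat.natCast_ne_top _ hPinf.symm
  have hroot : ∀ τ ∈ fundDomain,
      12 * (orderAt F τ).toNat = P.rootMultiplicity (kleinJ τ) * ellipticWeight τ := by
    intro τ hτ
    have h1 := hPτ τ
    rw [analyticOrderAt_kleinJ hτ, ← ENat.natCast_toNat (htop τ)] at h1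
    exact_mod_cast h1
  refine ⟨htop, hinf, ?_, ?_⟩
  · refine Set.Finite.of_injOn (f := kleinJ) (t := P.roots.toFinset) ?_
      (bijOn_kleinJ_fundDomain.injOn.mono fun τ h ↦ h.1) (Finset.finite_toSet _)
    rintro τ ⟨hτ, hτ0⟩
    have h1 : (orderAt F τ).toNat ≠ 0 := by simp [hτ0, htop τ]
    have h2 : P.rootMultiplicity (kleinJ τ) ≠ 0 := fun h ↦ by
      have := hroot τ hτ
      rw [h, zero_mul] at this
      lia
    rw [← Polynomial.count_roots] at h2
    simpa using Multiset.count_ne_zero.mp h2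
  -- The factor `e_τ` cancels the ramification index, so each term depends only on `j(τ)` and the
  -- sum can be taken over `ℂ`.
  · have hsum : ∑ᶠ τ ∈ fundDomain, ((orderAt F τ).toNat : ℚ) / (ellipticWeight τ : ℚ) =
        ∑ᶠ c ∈ (Set.univ : Set ℂ), (P.rootMultiplicity c : ℚ) / 12 := by
      refine finsum_mem_eq_of_bijOn kleinJ bijOn_kleinJ_fundDomain fun τ hτ ↦ ?_
      have h1 : (ellipticWeight τ : ℚ) ≠ 0 := by
        unfold ellipticWeight
        split_ifs <;> norm_num
      have h2 : (12 * (orderAt F τ).toNat : ℚ) =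
        P.rootMultiplicity (kleinJ τ) * ellipticWeight τ := by exact_mod_cast hroot τ hτ
      field_simp
      linarith
    have hfin : ∑ᶠ c ∈ (Set.univ : Set ℂ), (P.rootMultiplicity c : ℚ) / 12 =
        P.natDegree / 12 := by
      simp_rw [← finsum_rootMultiplicity P, div_eq_mul_inv, finsum_mem_univ]
      rw [finsum_mul]
    have h3 : 12 * (orderAtInfty F).toNat + P.natDegree = k.toNat := by
      rw [← ENat.natCast_toNat hinf] at hPinf
      exact_mod_cast hPinf
    have h4 : (12 * (orderAtInfty F).toNat + P.natDegree : ℚ) = k := by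
      have h5 : ((k.toNat : ℤ) : ℚ) = k := by rw [Int.toNat_of_nonneg hk]
      rw [← h5]
      exact_mod_cast h3
    rw [hsum, hfin, ← h4]
    ring
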